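/- **Definitions.** Let $G$ be a finite graph in which every vertex ranks its neighbours in a strict order (written $\succ$, best first). A vertex $u$ prefers a matching $M$ to a matching $M'$ if $u$ is matched in $M$ and unmatched in $M'$, or $u$ is matched in both and prefers its partner in $M$ to its partner in $M'$. Let $\phi(M,M')$ be the number of vertices that prefer $M$ to $M'$. A matching $M$ of $G$ is *popular* if $\phi(M,M')\ge\phi(M',M)$ for every matching $M'$ of $G$. With edge weights $w$, the weight of a matching is the sum of the weights of its edges. **The instance.** Let $H=(V_H,E_H)$ be a finite simple graph with $V_H=\{1,\dots,n_H\}$ and $m_H=|E_H|$. Let $G=(A\cup B,E)$ be the bipartite graph with $$A=\{a_0\}\cup\{a_i,a_i' : i\in V_H\}\cup\{s_e,s_e',s_e'' : e\in E_H\},\qquad B=\{b_0\}\cup\{b_i,b_i' : i\in V_H\}\cup\{t_e,t_e',t_e'' : e\in E_H\},$$ whose edges and strict preferences are given by the following lists (each vertex is adjacent exactly to the vertices on its list). For every edge $e=\{i,j\}\in E_H$ with $i<j$: $$s_e:\ t_e'\succ b_j\succ t_e'',\qquad s_e':\ t_e'\succ t_e,\qquad s_e'':\ t_e''\succ t_e,$$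 $$t_e:\ s_e''\succ a_i\succ s_e',\qquad t_e':\ s_e'\succ s_e,\qquad t_e'':\ s_e''\succ s_e.$$ For every $i\in V_H$: $$a_i:\ b_i\succ b_i'\succ b_0\succ\cdots,\qquad a_i':\ b_i\succ b_i',\qquad b_i:\ a_i\succ a_i'\succ a_0\succ\cdots,\qquad b_i':\ a_i\succ a_i',$$ where the tail of the list of $a_i$ consists of all $t_e$ such that $i$ is the lower-indexed endpoint of $e$, in an arbitrary order, and the tail of the list of $b_i$ consists of all $s_e$ such that $i$ is the higher-indexed endpoint of $e$, in an arbitrary order. The list of $a_0$ is an arbitrary permutation of $b_1,\dots,b_{n_H}$, and the list of $b_0$ is an arbitrary permutation of $a_1,\dots,a_{n_H}$. The edge weights are $w(s_e,t_e')=w(s_e,t_e'')=w(s_e',t_e)=w(s_e'',t_e)=2$ for all $e\in E_H$, $w(a_i,b_i)=w(a_i',b_i')=2$ for all $i\in V_H$, and $w=1$ on all other edges of $G$. **Theorem.** For every choice of the arbitrary orders above and every integer $k$ with $1\le k\le n_H$, the graph $H$ has a vertex cover of size $k$ if and only if $G$ has a popular matching of weight at least $5m_H+4n_H-2k$. -/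

import Mathlib

/-! ### Matchings under strict preferences -/

/-- Strict preference lists for the vertices of a graph `G`: every vertex `u` ranks its neighbours,
a smaller rank means more preferred, and different neighbours get different ranks. Only the order
of the ranks of the neighbours of `u` is ever used. -/
structure StrictPrefs {V : Type*} (G : SimpleGraph V) where
  rank : V → V → ℕ
  rank_injOn : ∀ u, Set.InjOn (rank u) (G.neighborSet u)

namespace StrictPrefs

variable {V : Type*} {G : SimpleGraph V}

/-- `u` prefers the matching `M` to the matching `M'`: either `u` is matched in `M` and unmatched
in `M'`, or `u` is matched in both and prefers its partner in `M` to its partner in `M'`. -/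
def Prefers (P : StrictPrefs G) (u : V) (M M' : G.Subgraph) : Prop :=
  (u ∈ M.support ∧ u ∉ M'.support) ∨
    ∃ v v', M.Adj u v ∧ M'.Adj u v' ∧ P.rank u v < P.rank u v'

/-- The number of vertices that prefer `M` to `M'`. -/
noncomputable def votes [Finite V] (P : StrictPrefs G) (M M' : G.Subgraph) : ℕ :=
  {u | P.Prefers u M M'}.ncard

/-- `M` is a popular matching: it loses the vote against no matching of `G`. -/
def IsPopular [Finite V] (P : StrictPrefs G) (M : G.Subgraph) : Prop :=
  M.IsMatching ∧ ∀ M' : G.Subgraph, M'.IsMatching → P.votes M' M ≤ P.votes M M'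

end StrictPrefs

/-- The weight of a matching (more generally, of a subgraph): the sum of its edge weights. -/
noncomputable def matchingWeight {V : Type*} [Finite V] {G : SimpleGraph V}
    (w : Sym2 V → ℕ) (M : G.Subgraph) : ℕ :=
  ∑ᶠ e ∈ M.edgeSet, w e

/-! ### The instance built from a graph `H` -/

namespace Gadget

/-- The side `A` of the instance; `I` is the vertex set and `E` the edge set of `H`. -/
inductive AVert (I E : Type) : Type
  | a0 : AVert I E
  | a (i : I) : AVert I E
  | a' (i : I) : AVert I E
  | s (e : E) : AVert I E
  | s' (e : E) : AVert I E
  | s'' (e : E) : AVert I E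

/-- The side `B` of the instance; `I` is the vertex set and `E` the edge set of `H`. -/
inductive BVert (I E : Type) : Type
  | b0 : BVert I E
  | b (i : I) : BVert I E
  | b' (i : I) : BVert I E
  | t (e : E) : BVert I E
  | t' (e : E) : BVert I E
  | t'' (e : E) : BVert I E

open AVert BVert

instance {I E : Type} [Finite I] [Finite E] : Finite (AVert I E) := by
  refine Finite.of_injective
    (β := Option (I ⊕ I ⊕ E ⊕ E ⊕ E))
    (fun
      | a0 => none
      | a i => some (.inl i)
      | a' i => some (.inr (.inl i))
      | s e => some (.inr (.inr (.inl e)))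
      | s' e => some (.inr (.inr (.inr (.inl e))))
      | s'' e => some (.inr (.inr (.inr (.inr e))))) ?_
  intro x y h
  cases x <;> cases y <;> simp_all

instance {I E : Type} [Finite I] [Finite E] : Finite (BVert I E) := by
  refine Finite.of_injective
    (β := Option (I ⊕ I ⊕ E ⊕ E ⊕ E))
    (fun
      | b0 => none
      | b i => some (.inl i)
      | b' i => some (.inr (.inl i))
      | t e => some (.inr (.inr (.inl e)))
      | t' e => some (.inr (.inr (.inr (.inl e))))
      | t'' e => some (.inr (.inr (.inr (.inr e))))) ?_
  intro x y h
  cases x <;> cases y <;> simp_all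

variable {n : ℕ} (H : SimpleGraph (Fin n))

/-- The vertex set `A ∪ B` of the instance built from `H`. -/
abbrev Vert : Type := AVert (Fin n) H.edgeSet ⊕ BVert (Fin n) H.edgeSet

/-- The edges of the instance. For an edge `e = {i, j}` of `H` with `i < j`, `e.1.inf = i` and
`e.1.sup = j`. -/
inductive Edge : AVert (Fin n) H.edgeSet → BVert (Fin n) H.edgeSet → Prop
  -- inside the gadget `C_i`
  | a_b (i : Fin n) : Edge (a i) (b i)
  | a_b' (i : Fin n) : Edge (a i) (b' i)
  | a'_b (i : Fin n) : Edge (a' i) (b i)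
  | a'_b' (i : Fin n) : Edge (a' i) (b' i)
  -- between `C_i` and the two extra vertices
  | a_b0 (i : Fin n) : Edge (a i) b0
  | a0_b (i : Fin n) : Edge a0 (b i)
  -- inside the gadget `D_e`
  | s_t' (e : H.edgeSet) : Edge (s e) (t' e)
  | s_t'' (e : H.edgeSet) : Edge (s e) (t'' e)
  | s'_t (e : H.edgeSet) : Edge (s' e) (t e)
  | s'_t' (e : H.edgeSet) : Edge (s' e) (t' e)
  | s''_t (e : H.edgeSet) : Edge (s'' e) (t e)
  | s''_t'' (e : H.edgeSet) : Edge (s'' e) (t'' e)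
  -- between `D_e` and the gadgets of the endpoints of `e`
  | a_t (e : H.edgeSet) (i : Fin n) (hi : e.1.inf = i) : Edge (a i) (t e)
  | s_b (e : H.edgeSet) (j : Fin n) (hj : e.1.sup = j) : Edge (s e) (b j)

/-- The graph underlying the instance; it is bipartite with sides `A` and `B`. -/
def graph : SimpleGraph (Vert H) where
  Adj
    | .inl x, .inr y => Edge H x y
    | .inr y, .inl x => Edge H x y
    | .inl _, .inl _ => False
    | .inr _, .inr _ => False
  symm := ⟨by rintro (x | x) (y | y) h <;> exact h⟩
  loopless := ⟨by rintro (x | x) h <;> exact h⟩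

/-- The arbitrary choices in the preference lists, given by ranks (smaller is better): the order of
the vertices `b_i` in the list of `a_0`, of the vertices `a_i` in the list of `b_0`, of the vertices
`t_e` at the end of the list of `a_i`, and of the vertices `s_e` at the end of the list of `b_i`. -/
structure Choices where
  a0 : Fin n ↪ ℕ
  b0 : Fin n ↪ ℕ
  a : Fin n → H.edgeSet ↪ ℕ
  b : Fin n → H.edgeSet ↪ ℕ

variable {H}

/-- Preference lists of the vertices of `A`; the value on non-neighbours is irrelevant. -/
def rankA (c : Choices H) : AVert (Fin n) H.edgeSet → BVert (Fin n) H.edgeSet → ℕ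
  | a0, b i => c.a0 i
  | a _, b _ => 0
  | a _, b' _ => 1
  | a _, b0 => 2
  | a i, t e => 3 + c.a i e
  | a' _, b _ => 0
  | a' _, b' _ => 1
  | s _, t' _ => 0
  | s _, b _ => 1
  | s _, t'' _ => 2
  | s' _, t' _ => 0
  | s' _, t _ => 1
  | s'' _, t'' _ => 0
  | s'' _, t _ => 1
  | _, _ => 0

/-- Preference lists of the vertices of `B`; the value on non-neighbours is irrelevant. -/
def rankB (c : Choices H) : BVert (Fin n) H.edgeSet → AVert (Fin n) H.edgeSet → ℕ
  | b0, a i => c.b0 i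
  | b _, a _ => 0
  | b _, a' _ => 1
  | b _, a0 => 2
  | b i, s e => 3 + c.b i e
  | b' _, a _ => 0
  | b' _, a' _ => 1
  | t _, s'' _ => 0
  | t _, a _ => 1
  | t _, s' _ => 2
  | t' _, s' _ => 0
  | t' _, s _ => 1
  | t'' _, s'' _ => 0
  | t'' _, s _ => 1
  | _, _ => 0

/-- The strict preference lists of the instance. -/
def prefs (c : Choices H) : StrictPrefs (graph H) where
  rank
    | .inl x, .inr y => rankA c x y
    | .inr y, .inl x => rankB c y x
    | .inl _, .inl _ => 0
    | .inr _, .inr _ => 0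
  rank_injOn := by
    rintro (x | x) (y | y) hy (z | z) hz h
    · exact hy.elim
    · exact hy.elim
    · exact hz.elim
    · replace hy : Edge H x y := hy
      replace hz : Edge H x z := hz
      cases hy <;> cases hz <;> simp_all [rankA] <;> omega
    · replace hy : Edge H y x := hy
      replace hz : Edge H z x := hz
      cases hy <;> cases hz <;> simp_all [rankB] <;> omega
    · exact hz.elim
    · exact hy.elim
    · exact hy.elim

variable (H)

/-- The edges of weight 2. -/
inductive Heavy : AVert (Fin n) H.edgeSet → BVert (Fin n) H.edgeSet → Prop
  | a_b (i : Fin n) : Heavy (a i) (b i)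
  | a'_b' (i : Fin n) : Heavy (a' i) (b' i)
  | s_t' (e : H.edgeSet) : Heavy (s e) (t' e)
  | s_t'' (e : H.edgeSet) : Heavy (s e) (t'' e)
  | s'_t (e : H.edgeSet) : Heavy (s' e) (t e)
  | s''_t (e : H.edgeSet) : Heavy (s'' e) (t e)

open Classical in
/-- The edge weights: 2 on the heavy edges and 1 on all others. -/
noncomputable def weight (e : Sym2 (Vert H)) : ℕ :=
  if ∃ x y, Heavy H x y ∧ e = s(Sum.inl x, Sum.inr y) then 2 else 1

end Gadget

/-! ### Matchings as involutions -/

/-! Call the gadget of `i` crossed when its edges are `a i`–`b' i` and `a' i`–`b i`.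

From a cover `U` to a matching: cross exactly the gadgets of `U` and use `a i`–`b i`, `a' i`–`b' i`
elsewhere, so crossing costs weight 2. In the gadget of each edge `e`, take one of two
configurations of weight 5, chosen by whether the lower endpoint lies in `U`. Popularity is
certified by an integral dual solution (`isPopular_of_witness`). The covering property is needed
only at the edges between `s e` and `b j`.

Conversely, local exchanges against a popular matching show that a gadget is crossed or contains `a
i`–`b i` (`partner_a`), and that an edge gadget has one of the two weight-5 configurations or leaves
`s e` unmatched. A weight-5 configuration forces the lower or the higher endpoint to be crossed
(`partner_a_inf`, `partner_a_sup`). Hence the crossed indices, together with one endpoint of each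
edge with `s e` unmatched, form a cover. Each element costs at least 2 of the maximal weight, so a
heavy matching gives a small cover. -/

open Classical in
/-- The partner of `v` in the matching `M`, or `v` itself if `v` is unmatched. -/
noncomputable def matchingPartner {V : Type*} {G : SimpleGraph V} (M : G.Subgraph) (v : V) : V :=
  if h : ∃ w, M.Adj v w then h.choose else v

namespace matchingPartner

variable {V : Type*} {G : SimpleGraph V} {M : G.Subgraph}

lemma adj_iff (hM : M.IsMatching) {v w : V} :
    M.Adj v w ↔ matchingPartner M v = w ∧ w ≠ v := by
  unfold matchingPartner
  split_ifs with h
  · constructor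
    · intro hw
      obtain ⟨x, -, hx⟩ := hM (M.edge_vert hw)
      exact ⟨(hx _ h.choose_spec).trans (hx _ hw).symm, (M.adj_sub hw).ne'⟩
    · rintro ⟨rfl, -⟩
      exact h.choose_spec
  · exact ⟨fun hw => (h ⟨w, hw⟩).elim, fun hw => (hw.2 hw.1.symm).elim⟩

lemma adj_self (hM : M.IsMatching) {v : V} (h : matchingPartner M v ≠ v) :
    M.Adj v (matchingPartner M v) :=
  (adj_iff hM).2 ⟨rfl, h⟩

lemma involutive (hM : M.IsMatching) : Function.Involutive (matchingPartner M) := by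
  intro v
  by_cases h : matchingPartner M v = v
  · rw [h, h]
  · exact ((adj_iff hM).1 (adj_self hM h).symm).1

lemma mem_support_iff (hM : M.IsMatching) {v : V} :
    v ∈ M.support ↔ matchingPartner M v ≠ v := by
  rw [SimpleGraph.Subgraph.mem_support]
  constructor
  · rintro ⟨w, hw⟩
    obtain ⟨h, hne⟩ := (adj_iff hM).1 hw
    rwa [h]
  · exact fun h => ⟨_, adj_self hM h⟩

end matchingPartner

/-- The matching whose edges are the pairs exchanged by an involution. -/
def matchingOfInvolution {V : Type*} (G : SimpleGraph V) (f : V → V) (hf : Function.Involutive f)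
    (hadj : ∀ v, f v ≠ v → G.Adj v (f v)) : G.Subgraph where
  verts := {v | f v ≠ v}
  Adj u v := f u = v ∧ v ≠ u
  adj_sub := by
    rintro u v ⟨rfl, h⟩
    exact hadj u h
  edge_vert := by
    rintro u v ⟨rfl, h⟩
    exact h
  symm := ⟨by
    rintro u v ⟨rfl, h⟩
    exact ⟨hf u, h.symm⟩⟩

section matchingOfInvolution

variable {V : Type*} {G : SimpleGraph V} {f : V → V} {hf : Function.Involutive f}
  {hadj : ∀ v, f v ≠ v → G.Adj v (f v)}

lemma matchingOfInvolution_isMatching : (matchingOfInvolution G f hf hadj).IsMatching :=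
  fun v hv => ⟨f v, ⟨rfl, hv⟩, fun _ hy => hy.1.symm⟩

lemma matchingPartner_matchingOfInvolution :
    matchingPartner (matchingOfInvolution G f hf hadj) = f := by
  funext v
  by_cases h : f v = v
  · rw [h]
    by_contra h'
    have := matchingPartner.adj_self matchingOfInvolution_isMatching h'
    exact h' (this.1.symm.trans h)
  · exact ((matchingPartner.adj_iff matchingOfInvolution_isMatching).1
      (show (matchingOfInvolution G f hf hadj).Adj v (f v) from ⟨rfl, h⟩)).1

end matchingOfInvolution

/-! ### Votes, weak duality and local exchanges. -/

namespace StrictPrefs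

variable {V : Type*} {G : SimpleGraph V} (P : StrictPrefs G)

/-- `u` prefers the partner `x` to the partner `y`, where `u` itself stands for no partner. -/
def Better (u x y : V) : Prop := x ≠ u ∧ (y = u ∨ P.rank u x < P.rank u y)

open Classical in
/-- The vote of `u` between the partners `x` and `y`, where `u` itself stands for no partner. -/
noncomputable def vote (u x y : V) : ℤ :=
  (if P.Better u x y then 1 else 0) - (if P.Better u y x then 1 else 0)

variable {P}

/-- Allows arbitrary decidability instances in place of the classical ones of the definition. -/
lemma vote_eq (u x y : V) [Decidable (P.Better u x y)] [Decidable (P.Better u y x)] :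
    P.vote u x y = (if P.Better u x y then 1 else 0) - (if P.Better u y x then 1 else 0) := by
  unfold vote
  congr

lemma vote_self (u x : V) : P.vote u x x = 0 := sub_self _

lemma vote_unmatched_left {u y : V} (h : y ≠ u) : P.vote u u y = -1 := by
  classical
  rw [vote_eq]
  simp [Better, h]

lemma prefers_iff {M M' : G.Subgraph} (hM : M.IsMatching) (hM' : M'.IsMatching) (u : V) :
    P.Prefers u M M' ↔ P.Better u (matchingPartner M u) (matchingPartner M' u) := by
  simp only [Prefers, Better, matchingPartner.mem_support_iff hM,
    matchingPartner.mem_support_iff hM', matchingPartner.adj_iff hM, matchingPartner.adj_iff hM']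
  constructor
  · rintro (⟨h, h'⟩ | ⟨v, v', ⟨rfl, h⟩, ⟨rfl, h'⟩, hr⟩)
    · exact ⟨h, .inl (not_not.1 h')⟩
    · exact ⟨h, .inr hr⟩
  · rintro ⟨h, h'⟩
    by_cases hu : matchingPartner M' u = u
    · exact .inl ⟨h, not_not.2 hu⟩
    · exact .inr ⟨_, _, ⟨rfl, h⟩, ⟨rfl, hu⟩, h'.resolve_left hu⟩

lemma votes_eq_sum [Fintype V] {M M' : G.Subgraph} (hM : M.IsMatching) (hM' : M'.IsMatching)
    [∀ u, Decidable (P.Better u (matchingPartner M u) (matchingPartner M' u))] :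
    (P.votes M M' : ℤ) =
      ∑ u, if P.Better u (matchingPartner M u) (matchingPartner M' u) then 1 else 0 := by
  classical
  simp only [votes, prefers_iff hM hM']
  rw [Set.ncard_eq_toFinset_card', Set.toFinset_ofPred, Finset.card_filter]
  push_cast
  exact Finset.sum_congr rfl fun u _ => by congr

lemma votes_le_iff [Fintype V] {M M' : G.Subgraph} (hM : M.IsMatching) (hM' : M'.IsMatching) :
    P.votes M' M ≤ P.votes M M' ↔
      ∑ u, P.vote u (matchingPartner M' u) (matchingPartner M u) ≤ 0 := by
  classical
  simp only [vote_eq, Finset.sum_sub_distrib]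
  rw [← votes_eq_sum hM hM', ← votes_eq_sum hM' hM]
  omega

/-- Weak duality: a matching with a witness is popular. -/
lemma isPopular_of_witness [Fintype V] {M : G.Subgraph} (hM : M.IsMatching) (α : V → ℤ)
    (hle : ∀ v, -1 ≤ α v) (hzero : ∀ v, α v + α (matchingPartner M v) = 0)
    (hedge : ∀ x y, G.Adj x y →
      P.vote x y (matchingPartner M x) + P.vote y x (matchingPartner M y) ≤ α x + α y) :
    P.IsPopular M := by
  refine ⟨hM, fun M' hM' => (votes_le_iff hM hM').2 ?_⟩
  have hp := matchingPartner.involutive hM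
  have hp' := matchingPartner.involutive hM'
  have h1 : ∑ v, α (matchingPartner M v) = ∑ v, α v := Equiv.sum_comp hp.toPerm α
  have h2 : ∑ v, (α v + α (matchingPartner M v)) = 0 := Finset.sum_eq_zero fun v _ => hzero v
  -- After subtracting `α` the claim is local along the edges of `M'`. Reindexing by the partner
  -- involution counts every vertex twice, so no pairs need to be chosen.
  set g : V → ℤ := fun v => P.vote v (matchingPartner M' v) (matchingPartner M v) - α v with hg
  have h3 : ∑ v, g (matchingPartner M' v) = ∑ v, g v := Equiv.sum_comp hp'.toPerm g
  have h4 : ∑ v, (g v + g (matchingPartner M' v)) ≤ 0 := by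
    refine Finset.sum_nonpos fun v _ => ?_
    simp only [hg, hp' v]
    by_cases h : matchingPartner M' v = v
    · rw [h]
      -- A vertex unmatched in `M'` votes -1 if `M` matches it; otherwise `hzero` at a fixed point
      -- gives `α v = 0`.
      have : P.vote v v (matchingPartner M v) ≤ α v := by
        by_cases hv : matchingPartner M v = v
        · have := hzero v
          rw [hv] at this ⊢
          rw [vote_self]
          omega
        · rw [vote_unmatched_left hv]
          exact hle v
      omega
    · have := hedge v _ (M'.adj_sub (matchingPartner.adj_self hM' h))
      omega
  rw [Finset.sum_add_distrib] at h2 h4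
  simp only [hg, Finset.sum_sub_distrib] at h3 h4
  omega

/-- A popular matching does not lose against the matching obtained by rematching the vertices
of a finite set `S` among themselves by `q`. -/
lemma IsPopular.exchange [Finite V] [DecidableEq V] {M : G.Subgraph} (hM : P.IsPopular M)
    (S : Finset V) (q : V → V)
    (hq : ∀ u ∈ S, q u ∈ S ∧ q (q u) = u ∧ G.Adj u (q u)) :
    ∑ u ∈ S, (P.vote u (q u) (matchingPartner M u) -
      if matchingPartner M u ∈ S then 0 else 1) ≤ 0 := by
  have := Fintype.ofFinite V
  obtain ⟨hM, hpop⟩ := hM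
  have hp := matchingPartner.involutive hM
  set p := matchingPartner M with hpdef
  let f : V → V := fun v => if v ∈ S then q v else if p v ∈ S then v else p v
  have hf : Function.Involutive f := by
    intro v
    by_cases hv : v ∈ S
    · simp [f, hv, hq v hv]
    · by_cases hv' : p v ∈ S
      · simp [f, hv, hv']
      · simp [f, hv, hv', hp v]
  have hadj : ∀ v, f v ≠ v → G.Adj v (f v) := by
    intro v
    by_cases hv : v ∈ S
    · simp [f, hv, hq v hv]
    · by_cases hv' : p v ∈ S
      · simp [f, hv, hv']
      · simp only [f, hv, hv', if_false]
        exact fun h => M.adj_sub (matchingPartner.adj_self hM h)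
  have h := (votes_le_iff hM matchingOfInvolution_isMatching).1
    (hpop (matchingOfInvolution G f hf hadj) matchingOfInvolution_isMatching)
  rw [matchingPartner_matchingOfInvolution, ← hpdef] at h
  have h1 : ∀ v, P.vote v (f v) (p v) = (if v ∈ S then P.vote v (q v) (p v) else 0) -
      (if v ∉ S ∧ p v ∈ S then 1 else 0) := by
    intro v
    by_cases hv : v ∈ S
    · simp [f, hv]
    · by_cases hv' : p v ∈ S
      · have : p v ≠ v := fun h => hv (h ▸ hv')
        simp [f, hv, hv', vote_unmatched_left this]
      · simp [f, hv, hv', vote_self]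
  -- A vertex outside `S` abandoned by its partner votes -1; this loss is charged to the partner,
  -- inside `S`.
  have h2 : ∑ v, (if v ∉ S ∧ p v ∈ S then (1 : ℤ) else 0) =
      ∑ v ∈ S, if p v ∈ S then 0 else 1 := by
    rw [← Equiv.sum_comp hp.toPerm]
    simp only [Function.Involutive.coe_toPerm, hp _]
    rw [← Finset.sum_filter_add_sum_filter_not Finset.univ (· ∈ S), Finset.filter_mem_eq_inter,
      Finset.univ_inter, Finset.sum_eq_zero (s := Finset.univ.filter (· ∉ S)), add_zero]
    · refine Finset.sum_congr rfl fun v hv => ?_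
      by_cases hv' : p v ∈ S <;> simp [hv, hv']
    · intro v hv
      simp [(Finset.mem_filter.1 hv).2]
  simp only [h1, Finset.sum_sub_distrib] at h
  rw [h2, ← Finset.sum_filter, Finset.filter_mem_eq_inter, Finset.univ_inter] at h
  rw [Finset.sum_sub_distrib]
  exact h

open Classical in
/-- The vote of `u` for the new partner `x`, diminished by the vote of the old partner of `u`
if it is left unmatched, being outside the list `L`. -/
noncomputable def gain (P : StrictPrefs G) (M : G.Subgraph) (L : List V) (u x : V) : ℤ :=
  P.vote u x (matchingPartner M u) - if matchingPartner M u ∈ L then 0 else 1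

lemma IsPopular.gain_one [Finite V] {M : G.Subgraph} (hM : P.IsPopular M) {x y : V}
    (h : G.Adj x y) : P.gain M [x, y] x y + P.gain M [x, y] y x ≤ 0 := by
  classical
  have hxy := h.ne
  have := hM.exchange {x, y} (fun v => if v = x then y else x)
    (by simp [hxy.symm, h, h.symm])
  rw [Finset.sum_pair hxy] at this
  simpa [gain, hxy.symm] using this

lemma IsPopular.gain_two [Finite V] {M : G.Subgraph} (hM : P.IsPopular M) {x y z w : V}
    (hn : [x, y, z, w].Nodup) (h : G.Adj x y) (h' : G.Adj z w) :
    P.gain M [x, y, z, w] x y + P.gain M [x, y, z, w] y x +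
      P.gain M [x, y, z, w] z w + P.gain M [x, y, z, w] w z ≤ 0 := by
  classical
  simp only [List.nodup_cons, List.mem_cons, List.not_mem_nil, or_false, not_or, not_false_eq_true,
    List.nodup_nil, and_true] at hn
  obtain ⟨⟨h1, h2, h3⟩, ⟨h4, h5⟩, h6⟩ := hn
  have := hM.exchange {x, y, z, w}
    (fun v => if v = x then y else if v = y then x else if v = z then w else z)
    (by simp [*, Ne.symm h1, Ne.symm h2, Ne.symm h3, Ne.symm h4, Ne.symm h5, Ne.symm h6,
      h.symm, h'.symm])
  rw [Finset.sum_insert (by simp [*]), Finset.sum_insert (by simp [*]),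
    Finset.sum_pair h6] at this
  simpa [gain, Ne.symm h1, Ne.symm h2, Ne.symm h3, Ne.symm h4, Ne.symm h5, Ne.symm h6,
    add_assoc] using this

lemma IsPopular.gain_three [Finite V] {M : G.Subgraph} (hM : P.IsPopular M) {x y z w u v : V}
    (hn : [x, y, z, w, u, v].Nodup) (h : G.Adj x y) (h' : G.Adj z w) (h'' : G.Adj u v) :
    P.gain M [x, y, z, w, u, v] x y + P.gain M [x, y, z, w, u, v] y x +
      P.gain M [x, y, z, w, u, v] z w + P.gain M [x, y, z, w, u, v] w z +
      P.gain M [x, y, z, w, u, v] u v + P.gain M [x, y, z, w, u, v] v u ≤ 0 := by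
  classical
  simp only [List.nodup_cons, List.mem_cons, List.not_mem_nil, or_false, not_or, not_false_eq_true,
    List.nodup_nil, and_true] at hn
  obtain ⟨⟨h1, h2, h3, h4, h5⟩, ⟨h6, h7, h8, h9⟩, ⟨h10, h11, h12⟩, ⟨h13, h14⟩, h15⟩ := hn
  have := hM.exchange {x, y, z, w, u, v}
    (fun t => if t = x then y else if t = y then x else if t = z then w else
      if t = w then z else if t = u then v else u)
    (by simp [*, Ne.symm h1, Ne.symm h2, Ne.symm h3, Ne.symm h4, Ne.symm h5, Ne.symm h6,
      Ne.symm h7, Ne.symm h8, Ne.symm h9, Ne.symm h10, Ne.symm h11, Ne.symm h12, Ne.symm h13,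
      Ne.symm h14, Ne.symm h15, h.symm, h'.symm, h''.symm])
  rw [Finset.sum_insert (by simp [*]), Finset.sum_insert (by simp [*]),
    Finset.sum_insert (by simp [*]), Finset.sum_insert (by simp [*]),
    Finset.sum_pair h15] at this
  simpa [gain, Ne.symm h1, Ne.symm h2, Ne.symm h3, Ne.symm h4, Ne.symm h5, Ne.symm h6,
    Ne.symm h7, Ne.symm h8, Ne.symm h9, Ne.symm h10, Ne.symm h11, Ne.symm h12, Ne.symm h13,
    Ne.symm h14, Ne.symm h15, add_assoc] using this

end StrictPrefs
namespace Gadget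

open AVert BVert StrictPrefs

/-! ### Weights -/

/-- The vertices of the side `A`, listed by kind. -/
def aVertEquiv (I E : Type) : AVert I E ≃ Option ((I ⊕ I) ⊕ (E ⊕ E ⊕ E)) where
  toFun
    | a0 => none
    | a i => some (.inl (.inl i))
    | a' i => some (.inl (.inr i))
    | s e => some (.inr (.inl e))
    | s' e => some (.inr (.inr (.inl e)))
    | s'' e => some (.inr (.inr (.inr e)))
  invFun
    | none => a0
    | some (.inl (.inl i)) => a i
    | some (.inl (.inr i)) => a' i
    | some (.inr (.inl e)) => s e
    | some (.inr (.inr (.inl e))) => s' e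
    | some (.inr (.inr (.inr e))) => s'' e
  left_inv x := by cases x <;> rfl
  right_inv x := by rcases x with _ | ((_ | _) | (_ | _ | _)) <;> rfl

lemma sum_aVert {I E : Type} [Fintype I] [Fintype E] [Fintype (AVert I E)] (g : AVert I E → ℕ) :
    ∑ x, g x =
      g a0 + ∑ i, (g (a i) + g (a' i)) + ∑ e, (g (s e) + g (s' e) + g (s'' e)) := by
  rw [← Equiv.sum_comp (aVertEquiv I E).symm]
  simp only [Fintype.sum_option, Fintype.sum_sum_type, Finset.sum_add_distrib]
  simp only [aVertEquiv, Equiv.coe_fn_symm_mk]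
  ring

variable {n : ℕ} {H : SimpleGraph (Fin n)}

open Classical in
lemma weight_mk (x : AVert (Fin n) H.edgeSet) (y : BVert (Fin n) H.edgeSet) :
    weight H s(Sum.inl x, Sum.inr y) = if Heavy H x y then 2 else 1 := by
  simp [weight]

/-- The weight of the edge that the matching `M` has at the vertex `x` of the side `A`. -/
noncomputable def partnerWeight (M : (graph H).Subgraph) (x : AVert (Fin n) H.edgeSet) : ℕ :=
  match matchingPartner M (.inl x) with
  | .inl _ => 0
  | .inr y => weight H s(.inl x, .inr y)

lemma partner_inl {M : (graph H).Subgraph} (hM : M.IsMatching) (x : AVert (Fin n) H.edgeSet) :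
    matchingPartner M (.inl x) = .inl x ∨
      ∃ y, Edge H x y ∧ matchingPartner M (.inl x) = .inr y := by
  by_cases h : matchingPartner M (.inl x) = .inl x
  · exact .inl h
  · have h' := M.adj_sub (matchingPartner.adj_self hM h)
    rcases hy : matchingPartner M (.inl x) with y | y <;> rw [hy] at h'
    · exact h'.elim
    · exact .inr ⟨y, h', rfl⟩

lemma partner_inr {M : (graph H).Subgraph} (hM : M.IsMatching) (y : BVert (Fin n) H.edgeSet) :
    matchingPartner M (.inr y) = .inr y ∨
      ∃ x, Edge H x y ∧ matchingPartner M (.inr y) = .inl x := by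
  by_cases h : matchingPartner M (.inr y) = .inr y
  · exact .inl h
  · have h' := M.adj_sub (matchingPartner.adj_self hM h)
    rcases hx : matchingPartner M (.inr y) with x | x <;> rw [hx] at h'
    · exact .inr ⟨x, h', rfl⟩
    · exact h'.elim

/-- By bipartiteness every edge of `M` has exactly one end in `A`, so the edges of `M` correspond to
the matched vertices of `A`. -/
lemma matchingWeight_eq_sum [Fintype (AVert (Fin n) H.edgeSet)] {M : (graph H).Subgraph}
    (hM : M.IsMatching) :
    matchingWeight (weight H) M = ∑ x, partnerWeight M x := by
  classical
  let f : AVert (Fin n) H.edgeSet → Sym2 (Vert H) :=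
    fun x => s(.inl x, matchingPartner M (.inl x))
  let T : Set (AVert (Fin n) H.edgeSet) := {x | matchingPartner M (.inl x) ≠ .inl x}
  have himage : M.edgeSet = f '' T := by
    ext e
    induction e using Sym2.ind with
    | _ u v =>
      rw [SimpleGraph.Subgraph.mem_edgeSet]
      constructor
      · intro h
        have hadj := M.adj_sub h
        rcases u with x | x <;> rcases v with y | y
        · exact hadj.elim
        · obtain ⟨h1, h2⟩ := (matchingPartner.adj_iff hM).1 h
          exact ⟨x, by simp [T, h1], by simp [f, h1]⟩
        · obtain ⟨h1, h2⟩ := (matchingPartner.adj_iff hM).1 h.symm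
          exact ⟨y, by simp [T, h1], by simp [f, h1]⟩
        · exact hadj.elim
      · rintro ⟨x, hx, he⟩
        have : s(u, v) ∈ M.edgeSet := by
          rw [← he]
          exact matchingPartner.adj_self hM hx
        exact this
  have hinj : Set.InjOn f T := by
    intro x hx x' hx' h
    rcases partner_inl hM x with h1 | ⟨y, -, h1⟩
    · exact (hx h1).elim
    rcases partner_inl hM x' with h2 | ⟨y', -, h2⟩
    · exact (hx' h2).elim
    simp only [f, h1, h2] at h
    simpa using (by simpa using h : x = x' ∧ y = y').1
  rw [matchingWeight, himage, finsum_mem_image hinj, finsum_mem_def, finsum_eq_sum_of_fintype]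
  refine Finset.sum_congr rfl fun x _ => ?_
  rcases partner_inl hM x with h1 | ⟨y, -, h1⟩ <;> simp [T, f, partnerWeight, h1]

/-! ### Structure of the popular matchings -/

@[simp]
lemma prefs_rank_inl (c : Choices H) (x : AVert (Fin n) H.edgeSet) (y : BVert (Fin n) H.edgeSet) :
    (prefs c).rank (.inl x) (.inr y) = rankA c x y := rfl

@[simp]
lemma prefs_rank_inr (c : Choices H) (x : AVert (Fin n) H.edgeSet) (y : BVert (Fin n) H.edgeSet) :
    (prefs c).rank (.inr y) (.inl x) = rankB c y x := rfl

section Popular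

variable {c : Choices H} {M : (graph H).Subgraph}

lemma partner_symm (hM : M.IsMatching) {u v : Vert H} (h : matchingPartner M u = v) :
    matchingPartner M v = u := h ▸ matchingPartner.involutive hM u

@[simp]
lemma one_lt_three_add (m : ℕ) : 1 < 3 + m := by omega

/-- The only ways in which a popular matching can match the vertices `a i` and `b i`. -/
lemma partner_a (hM : (prefs c).IsPopular M) (i : Fin n) :
    matchingPartner M (.inl (a i)) = .inr (b i) ∨
      matchingPartner M (.inl (a i)) = .inr (b' i) ∧
        matchingPartner M (.inl (a' i)) = .inr (b i) := by
  classical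
  rw [or_iff_not_imp_left]
  intro h
  have hb : matchingPartner M (.inr (b i)) ≠ .inl (a i) := fun h' => h (partner_symm hM.1 h')
  obtain ⟨L, hL⟩ : ∃ L : List (Vert H),
    L = [.inl (a i), .inr (b' i), .inl (a' i), .inr (b i)] := ⟨_, rfl⟩
  -- Test `M` against the crossed state. Once `a i`–`b i` is excluded, `a i` and `b i` each gain at
  -- least as much as an abandoned outside partner loses. The old partners of `a' i` and `b' i` lie
  -- in `L`, so any change there is a net gain.
  have h1 : 0 ≤ (prefs c).gain M L (.inl (a i)) (.inr (b' i)) := by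
    rcases partner_inl hM.1 (a i) with h1 | ⟨y, hy, h1⟩
    · simp [gain, vote_eq, Better, h1, hL]
    · cases hy <;> simp_all [gain, vote_eq, Better, rankA]
  have h2 : 0 ≤ (prefs c).gain M L (.inr (b' i)) (.inl (a i)) ∧
      (matchingPartner M (.inr (b' i)) ≠ .inl (a i) →
        1 ≤ (prefs c).gain M L (.inr (b' i)) (.inl (a i))) := by
    rcases partner_inr hM.1 (b' i) with h1 | ⟨y, hy, h1⟩
    · simp [gain, vote_eq, Better, h1, hL]
    · cases hy <;> simp [gain, vote_eq, Better, rankB, h1, hL]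
  have h3 : 0 ≤ (prefs c).gain M L (.inl (a' i)) (.inr (b i)) ∧
      (matchingPartner M (.inl (a' i)) ≠ .inr (b i) →
        1 ≤ (prefs c).gain M L (.inl (a' i)) (.inr (b i))) := by
    rcases partner_inl hM.1 (a' i) with h1 | ⟨y, hy, h1⟩
    · simp [gain, vote_eq, Better, h1, hL]
    · cases hy <;> simp [gain, vote_eq, Better, rankA, h1, hL]
  have h4 : 0 ≤ (prefs c).gain M L (.inr (b i)) (.inl (a' i)) := by
    rcases partner_inr hM.1 (b i) with h1 | ⟨y, hy, h1⟩
    · simp [gain, vote_eq, Better, h1, hL]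
    · cases hy <;> simp_all [gain, vote_eq, Better, rankB]
  have hex := hM.gain_two (x := .inl (a i)) (y := .inr (b' i)) (z := .inl (a' i)) (w := .inr (b i))
    (by simp) (Edge.a_b' i) (Edge.a'_b i)
  rw [← hL] at hex
  refine ⟨partner_symm hM.1 ?_, ?_⟩ <;> by_contra h'
  · have := h2.2 h'
    omega
  · have := h3.2 h'
    omega

/-- Every `b i` is already taken by `a i` or `a' i`. -/
lemma partner_a0 (hM : (prefs c).IsPopular M) :
    matchingPartner M (.inl a0) = .inl a0 := by
  rcases partner_inl hM.1 a0 with h | ⟨y, hy, h⟩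
  · exact h
  · cases hy with
    | a0_b i =>
      have h' := partner_symm hM.1 h
      rcases partner_a hM i with h1 | ⟨-, h1⟩ <;> simp [partner_symm hM.1 h1] at h'

lemma partner_b0 (hM : (prefs c).IsPopular M) :
    matchingPartner M (.inr b0) = .inr b0 := by
  rcases partner_inr hM.1 b0 with h | ⟨y, hy, h⟩
  · exact h
  · cases hy with
    | a_b0 i =>
      have h' := partner_symm hM.1 h
      rcases partner_a hM i with h1 | ⟨h1, -⟩ <;> simp [h1] at h'

/-- `s' e` and `t' e` are each other's first choices. Bringing them together wins the vote unless
both abandon a partner, and each has only one other neighbour. -/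
lemma partner_s' (hM : (prefs c).IsPopular M) (e : H.edgeSet) :
    matchingPartner M (.inl (s' e)) = .inr (t' e) ∨
      matchingPartner M (.inl (s' e)) = .inr (t e) ∧
        matchingPartner M (.inl (s e)) = .inr (t' e) := by
  classical
  rw [or_iff_not_imp_left]
  intro h
  have ht : matchingPartner M (.inr (t' e)) ≠ .inl (s' e) := fun h' => h (partner_symm hM.1 h')
  obtain ⟨L, hL⟩ : ∃ L : List (Vert H), L = [.inl (s' e), .inr (t' e)] := ⟨_, rfl⟩
  have h1 : 0 ≤ (prefs c).gain M L (.inl (s' e)) (.inr (t' e)) ∧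
      (matchingPartner M (.inl (s' e)) ≠ .inr (t e) →
        1 ≤ (prefs c).gain M L (.inl (s' e)) (.inr (t' e))) := by
    rcases partner_inl hM.1 (s' e) with h1 | ⟨y, hy, h1⟩
    · simp [gain, vote_eq, Better, h1, hL]
    · cases hy <;> simp_all [gain, vote_eq, Better, rankA]
  have h2 : 0 ≤ (prefs c).gain M L (.inr (t' e)) (.inl (s' e)) ∧
      (matchingPartner M (.inr (t' e)) ≠ .inl (s e) →
        1 ≤ (prefs c).gain M L (.inr (t' e)) (.inl (s' e))) := by
    rcases partner_inr hM.1 (t' e) with h1 | ⟨y, hy, h1⟩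
    · simp [gain, vote_eq, Better, h1, hL]
    · cases hy <;> simp_all [gain, vote_eq, Better, rankB]
  have hex := hM.gain_one (x := .inl (s' e)) (y := .inr (t' e)) (Edge.s'_t' e)
  rw [← hL] at hex
  refine ⟨?_, partner_symm hM.1 ?_⟩ <;> by_contra h'
  · have := h1.2 h'
    omega
  · have := h2.2 h'
    omega

lemma partner_s'' (hM : (prefs c).IsPopular M) (e : H.edgeSet) :
    matchingPartner M (.inl (s'' e)) = .inr (t'' e) ∨
      matchingPartner M (.inl (s'' e)) = .inr (t e) ∧
        matchingPartner M (.inl (s e)) = .inr (t'' e) := by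
  classical
  rw [or_iff_not_imp_left]
  intro h
  have ht : matchingPartner M (.inr (t'' e)) ≠ .inl (s'' e) := fun h' => h (partner_symm hM.1 h')
  obtain ⟨L, hL⟩ : ∃ L : List (Vert H), L = [.inl (s'' e), .inr (t'' e)] := ⟨_, rfl⟩
  have h1 : 0 ≤ (prefs c).gain M L (.inl (s'' e)) (.inr (t'' e)) ∧
      (matchingPartner M (.inl (s'' e)) ≠ .inr (t e) →
        1 ≤ (prefs c).gain M L (.inl (s'' e)) (.inr (t'' e))) := by
    rcases partner_inl hM.1 (s'' e) with h1 | ⟨y, hy, h1⟩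
    · simp [gain, vote_eq, Better, h1, hL]
    · cases hy <;> simp_all [gain, vote_eq, Better, rankA]
  have h2 : 0 ≤ (prefs c).gain M L (.inr (t'' e)) (.inl (s'' e)) ∧
      (matchingPartner M (.inr (t'' e)) ≠ .inl (s e) →
        1 ≤ (prefs c).gain M L (.inr (t'' e)) (.inl (s'' e))) := by
    rcases partner_inr hM.1 (t'' e) with h1 | ⟨y, hy, h1⟩
    · simp [gain, vote_eq, Better, h1, hL]
    · cases hy <;> simp_all [gain, vote_eq, Better, rankB]
  have hex := hM.gain_one (x := .inl (s'' e)) (y := .inr (t'' e)) (Edge.s''_t'' e)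
  rw [← hL] at hex
  refine ⟨?_, partner_symm hM.1 ?_⟩ <;> by_contra h'
  · have := h1.2 h'
    omega
  · have := h2.2 h'
    omega

/-- If `s' e` is matched to `t e`, then the gadget of the lower endpoint is not stable. -/
lemma partner_a_inf (hM : (prefs c).IsPopular M) (e : H.edgeSet)
    (he : matchingPartner M (.inl (s' e)) = .inr (t e)) :
    matchingPartner M (.inl (a e.1.inf)) = .inr (b' e.1.inf) := by
  classical
  rcases partner_a hM e.1.inf with h | ⟨h, -⟩
  swap
  · exact h
  exfalso
  have h1 : matchingPartner M (.inl (s e)) = .inr (t' e) := by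
    rcases partner_s' hM e with h' | ⟨-, h'⟩
    · simp [he] at h'
    · exact h'
  -- Here `s' e`, `t' e`, `t e` and `a0` improve, while `a e.1.inf` and `b e.1.inf` get worse and `s
  -- e` loses its partner: 4 votes to 3. The vote of `a0` decides.
  have hex := hM.gain_three (x := .inl (s' e)) (y := .inr (t' e)) (z := .inl (a e.1.inf))
    (w := .inr (t e)) (u := .inl a0) (v := .inr (b e.1.inf))
    (by simp) (Edge.s'_t' e) (Edge.a_t e _ rfl) (Edge.a0_b _)
  simp [gain, vote_eq, Better, he, h, partner_symm hM.1 h, partner_symm hM.1 he,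
    partner_symm hM.1 h1, partner_a0 hM, rankA, rankB] at hex

/-- If `s'' e` is matched to `t e`, then the gadget of the higher endpoint is not stable. -/
lemma partner_a_sup (hM : (prefs c).IsPopular M) (e : H.edgeSet)
    (he : matchingPartner M (.inl (s'' e)) = .inr (t e)) :
    matchingPartner M (.inl (a e.1.sup)) = .inr (b' e.1.sup) := by
  classical
  rcases partner_a hM e.1.sup with h | ⟨h, -⟩
  swap
  · exact h
  exfalso
  have h1 : matchingPartner M (.inl (s e)) = .inr (t'' e) := by
    rcases partner_s'' hM e with h' | ⟨-, h'⟩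
    · simp [he] at h'
    · exact h'
  -- Again 4 votes to 3: `s'' e`, `t'' e`, `s e` and `b0` against `b e.1.sup`, `a e.1.sup` and the
  -- abandoned `t e`.
  have hex := hM.gain_three (x := .inl (s'' e)) (y := .inr (t'' e)) (z := .inl (s e))
    (w := .inr (b e.1.sup)) (u := .inl (a e.1.sup)) (v := .inr b0)
    (by simp) (Edge.s''_t'' e) (Edge.s_b e _ rfl) (Edge.a_b0 _)
  simp [gain, vote_eq, Better, he, h, h1, partner_symm hM.1 h, partner_symm hM.1 h1,
    partner_b0 hM, rankA, rankB] at hex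

lemma partner_s (hM : (prefs c).IsPopular M) (e : H.edgeSet)
    (h' : matchingPartner M (.inl (s' e)) = .inr (t' e))
    (h'' : matchingPartner M (.inl (s'' e)) = .inr (t'' e)) :
    matchingPartner M (.inl (s e)) = .inl (s e) := by
  rcases partner_inl hM.1 (s e) with h | ⟨y, hy, h⟩
  · exact h
  · cases hy with
    | s_t' => simpa [partner_symm hM.1 h'] using partner_symm hM.1 h
    | s_t'' => simpa [partner_symm hM.1 h''] using partner_symm hM.1 h
    | s_b _ j =>
      have hb := partner_symm hM.1 h
      rcases partner_a hM j with k | ⟨-, k⟩ <;> simp [partner_symm hM.1 k] at hb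

open Classical in
lemma partnerWeight_a_add (hM : (prefs c).IsPopular M) (i : Fin n) :
    partnerWeight M (a i) + partnerWeight M (a' i) +
      2 * (if matchingPartner M (.inl (a i)) = .inr (b' i) then 1 else 0) ≤ 4 := by
  have hle : partnerWeight M (a' i) ≤ 2 := by
    unfold partnerWeight
    split
    · omega
    · rw [weight_mk]
      split_ifs <;> omega
  have n1 : ¬ Heavy H (a i) (b' i) := by rintro ⟨⟩
  have n2 : ¬ Heavy H (a' i) (b i) := by rintro ⟨⟩
  rcases partner_a hM i with h | ⟨h, h'⟩
  · simp [partnerWeight, weight_mk, h, Heavy.a_b] at hle ⊢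
    omega
  · simp [partnerWeight, weight_mk, h, h', n1, n2]

-- A configuration with `s e` matched weighs 5. With `s e` unmatched only two light edges remain, so
-- the penalty 2 is not even tight.
open Classical in
lemma partnerWeight_s_add (hM : (prefs c).IsPopular M) (e : H.edgeSet) :
    partnerWeight M (s e) + partnerWeight M (s' e) + partnerWeight M (s'' e) +
      2 * (if matchingPartner M (.inl (s e)) = .inl (s e) then 1 else 0) ≤ 5 := by
  have n1 : ¬ Heavy H (s' e) (t' e) := by rintro ⟨⟩
  have n2 : ¬ Heavy H (s'' e) (t'' e) := by rintro ⟨⟩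
  rcases partner_s' hM e with h' | ⟨h', h⟩ <;> rcases partner_s'' hM e with h'' | ⟨h'', k⟩
  · have hs := partner_s hM e h' h''
    simp [partnerWeight, weight_mk, h', h'', hs, n1, n2]
  · simp [partnerWeight, weight_mk, h', h'', k, n1, Heavy.s_t'', Heavy.s''_t]
  · simp [partnerWeight, weight_mk, h', h'', h, n2, Heavy.s_t', Heavy.s'_t]
  -- Impossible: `t e` would have both `s' e` and `s'' e` as partners.
  · have ht := partner_symm hM.1 h''
    simp [partner_symm hM.1 h'] at ht

end Popular
-- From heavy popular matchings to vertex covers.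
lemma isVertexCover_iff {U : Set (Fin n)} :
    H.IsVertexCover U ↔ ∀ e : H.edgeSet, e.1.inf ∈ U ∨ e.1.sup ∈ U := by
  constructor
  · rintro h ⟨e, he⟩
    induction e using Sym2.ind with
    | _ x y =>
      have := h he
      rcases le_total x y with hxy | hxy <;> simp [hxy] <;> tauto
  · intro h x y hxy
    have := h ⟨s(x, y), hxy⟩
    rcases le_total x y with hxy | hxy <;> simp [hxy] at this <;> tauto

/-- A heavy popular matching yields a small vertex cover. -/
lemma exists_vertexCover_of_isPopular {c : Choices H} {M : (graph H).Subgraph}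
    (hM : (prefs c).IsPopular M) (k : ℕ)
    (hk : 5 * (H.edgeSet.ncard : ℤ) + 4 * (n : ℤ) - 2 * (k : ℤ) ≤
      (matchingWeight (weight H) M : ℤ)) :
    ∃ U : Finset (Fin n), H.IsVertexCover (U : Set (Fin n)) ∧ U.card ≤ k := by
  classical
  have := Fintype.ofFinite (AVert (Fin n) H.edgeSet)
  -- Crossed indices; `F` collects the edges that no crossed endpoint need cover, and the lower
  -- endpoint is an arbitrary choice for them.
  let U₁ := Finset.univ.filter fun i => matchingPartner M (.inl (a i)) = .inr (b' i)
  let F := Finset.univ.filter fun e : H.edgeSet => matchingPartner M (.inl (s e)) = .inl (s e)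
  refine ⟨U₁ ∪ F.image fun e => e.1.inf, isVertexCover_iff.2 fun e => ?_, ?_⟩
  · by_cases hs : matchingPartner M (.inl (s e)) = .inl (s e)
    · left
      simp only [Finset.coe_union, Finset.coe_image]
      exact .inr ⟨e, by simpa [F] using hs, rfl⟩
    · rcases partner_s' hM e with h' | ⟨h', -⟩
      · rcases partner_s'' hM e with h'' | ⟨h'', -⟩
        · exact (hs (partner_s hM e h' h'')).elim
        · right
          simp [U₁, partner_a_sup hM e h'']
      · left
        simp [U₁, partner_a_inf hM e h']
  · have h1 := Finset.sum_le_sum fun i (_ : i ∈ Finset.univ) => partnerWeight_a_add hM i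
    have h2 := Finset.sum_le_sum fun e (_ : e ∈ Finset.univ) => partnerWeight_s_add hM e
    rw [Finset.sum_add_distrib, ← Finset.mul_sum, ← Finset.card_filter] at h1 h2
    have h3 : Fintype.card H.edgeSet = H.edgeSet.ncard := by
      rw [← Nat.card_eq_fintype_card, Nat.card_coe_set_eq]
    simp only [Finset.sum_const, Finset.card_univ, Fintype.card_fin, smul_eq_mul, h3] at h1 h2
    have h4 : partnerWeight M a0 = 0 := by simp [partnerWeight, partner_a0 hM]
    rw [matchingWeight_eq_sum hM.1, sum_aVert, h4] at hk
    push_cast at hk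
    have h5 := Finset.card_union_le U₁ (F.image fun e => e.1.inf)
    have h6 := Finset.card_image_le (s := F) (f := fun e => e.1.inf)
    zify at *
    linarith

/-! ### The matching given by a vertex cover -/

section Cover

variable (H) (U : Set (Fin n))

open Classical in
/-- The partners in the matching given by the vertex cover `U`. -/
noncomputable def coverPartner : Vert H → Vert H
  | .inl a0 => .inl a0
  | .inr b0 => .inr b0
  | .inl (a i) => if i ∈ U then .inr (b' i) else .inr (b i)
  | .inl (a' i) => if i ∈ U then .inr (b i) else .inr (b' i)
  | .inr (b i) => if i ∈ U then .inl (a' i) else .inl (a i)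
  | .inr (b' i) => if i ∈ U then .inl (a i) else .inl (a' i)
  | .inl (s e) => if e.1.inf ∈ U then .inr (t' e) else .inr (t'' e)
  | .inl (s' e) => if e.1.inf ∈ U then .inr (t e) else .inr (t' e)
  | .inl (s'' e) => if e.1.inf ∈ U then .inr (t'' e) else .inr (t e)
  | .inr (t e) => if e.1.inf ∈ U then .inl (s' e) else .inl (s'' e)
  | .inr (t' e) => if e.1.inf ∈ U then .inl (s e) else .inl (s' e)
  | .inr (t'' e) => if e.1.inf ∈ U then .inl (s'' e) else .inl (s e)

open Classical in
/-- The witness of the popularity of the matching given by the vertex cover `U`. -/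
noncomputable def coverWitness : Vert H → ℤ
  | .inl a0 => 0
  | .inr b0 => 0
  | .inl (a i) => if i ∈ U then 1 else 0
  | .inl (a' i) => if i ∈ U then -1 else 0
  | .inr (b i) => if i ∈ U then 1 else 0
  | .inr (b' i) => if i ∈ U then -1 else 0
  | .inl (s _) => -1
  | .inl (s' e) => if e.1.inf ∈ U then 1 else -1
  | .inl (s'' _) => 1
  | .inr (t _) => -1
  | .inr (t' _) => 1
  | .inr (t'' e) => if e.1.inf ∈ U then -1 else 1

lemma coverPartner_involutive : Function.Involutive (coverPartner H U) := by
  rintro ((_ | i | i | e | e | e) | (_ | i | i | e | e | e))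
  · rfl
  iterate 2 by_cases h : i ∈ U <;> simp [coverPartner, h]
  iterate 3 by_cases h : e.1.inf ∈ U <;> simp [coverPartner, h]
  · rfl
  iterate 2 by_cases h : i ∈ U <;> simp [coverPartner, h]
  iterate 3 by_cases h : e.1.inf ∈ U <;> simp [coverPartner, h]

lemma coverPartner_adj (v : Vert H) (hv : coverPartner H U v ≠ v) :
    (graph H).Adj v (coverPartner H U v) := by
  rcases v with (_ | i | i | e | e | e) | (_ | i | i | e | e | e)
  · exact (hv rfl).elim
  iterate 2 by_cases h : i ∈ U <;> simp only [coverPartner, h, if_true, if_false] <;> constructor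
  iterate 3
    by_cases h : e.1.inf ∈ U <;> simp only [coverPartner, h, if_true, if_false] <;> constructor
  · exact (hv rfl).elim
  iterate 2 by_cases h : i ∈ U <;> simp only [coverPartner, h, if_true, if_false] <;> constructor
  iterate 3
    by_cases h : e.1.inf ∈ U <;> simp only [coverPartner, h, if_true, if_false] <;> constructor

/-- The matching given by the vertex cover `U`. -/
noncomputable def coverMatching : (graph H).Subgraph :=
  matchingOfInvolution (graph H) (coverPartner H U) (coverPartner_involutive H U)
    (coverPartner_adj H U)

lemma coverMatching_isMatching : (coverMatching H U).IsMatching :=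
  matchingOfInvolution_isMatching

variable {H U}

lemma coverMatching_isPopular (c : Choices H) (hU : H.IsVertexCover U) :
    (prefs c).IsPopular (coverMatching H U) := by
  classical
  have := Fintype.ofFinite (Vert H)
  rw [isVertexCover_iff] at hU
  refine isPopular_of_witness (coverMatching_isMatching H U) (coverWitness H U) ?_ ?_ ?_
  · rintro ((_ | i | i | e | e | e) | (_ | i | i | e | e | e)) <;>
      simp only [coverWitness] <;> (try split_ifs) <;> norm_num
  · intro v
    rw [coverMatching, matchingPartner_matchingOfInvolution]
    rcases v with (_ | i | i | e | e | e) | (_ | i | i | e | e | e)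
    · rfl
    iterate 2 by_cases h : i ∈ U <;> simp [coverPartner, coverWitness, h]
    iterate 3 by_cases h : e.1.inf ∈ U <;> simp [coverPartner, coverWitness, h]
    · rfl
    iterate 2 by_cases h : i ∈ U <;> simp [coverPartner, coverWitness, h]
    iterate 3 by_cases h : e.1.inf ∈ U <;> simp [coverPartner, coverWitness, h]
  · rw [coverMatching, matchingPartner_matchingOfInvolution]
    have key : ∀ x y, Edge H x y →
        (prefs c).vote (.inl x) (.inr y) (coverPartner H U (.inl x)) +
          (prefs c).vote (.inr y) (.inl x) (coverPartner H U (.inr y)) ≤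
        coverWitness H U (.inl x) + coverWitness H U (.inr y) := by
      intro x y h
      cases h with
      | a_t e i hi =>
        subst hi
        by_cases h : e.1.inf ∈ U <;>
          simp [coverPartner, coverWitness, h, vote_eq, Better, rankA, rankB]
      | s_b e j hj =>
        subst hj
        -- If the lower endpoint is not in `U`, the votes of `s e` and `b j` cancel while the
        -- witness of `s e` is -1. So `b j` needs witness 1, that is, the higher endpoint must lie
        -- in `U`.
        have := hU e
        by_cases h : e.1.inf ∈ U <;> by_cases h' : e.1.sup ∈ U <;>
          simp_all [coverPartner, coverWitness, vote_eq, Better, rankA, rankB]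
      | a_b i | a_b' i | a'_b i | a'_b' i | a_b0 i | a0_b i =>
        by_cases h : i ∈ U <;>
          simp [coverPartner, coverWitness, h, vote_eq, Better, rankA, rankB]
      | s_t' e | s_t'' e | s'_t e | s'_t' e | s''_t e | s''_t'' e =>
        by_cases h : e.1.inf ∈ U <;>
          simp [coverPartner, coverWitness, h, vote_eq, Better, rankA, rankB]
    rintro (x | y) (x' | y') h
    · exact h.elim
    · exact key _ _ h
    · rw [add_comm, add_comm (coverWitness H U _)]
      exact key _ _ h
    · exact h.elim

lemma matchingWeight_coverMatching (U : Finset (Fin n)) :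
    (matchingWeight (weight H) (coverMatching H (U : Set (Fin n))) : ℤ) =
      5 * (H.edgeSet.ncard : ℤ) + 4 * (n : ℤ) - 2 * (U.card : ℤ) := by
  classical
  have := Fintype.ofFinite (AVert (Fin n) H.edgeSet)
  have n1 (i) : ¬ Heavy H (a i) (b' i) := by rintro ⟨⟩
  have n2 (i) : ¬ Heavy H (a' i) (b i) := by rintro ⟨⟩
  have n3 (e) : ¬ Heavy H (s' e) (t' e) := by rintro ⟨⟩
  have n4 (e) : ¬ Heavy H (s'' e) (t'' e) := by rintro ⟨⟩
  have h3 : Fintype.card H.edgeSet = H.edgeSet.ncard := by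
    rw [← Nat.card_eq_fintype_card, Nat.card_coe_set_eq]
  have hp : matchingPartner (coverMatching H (U : Set (Fin n))) = coverPartner H U :=
    matchingPartner_matchingOfInvolution
  set w := partnerWeight (coverMatching H (U : Set (Fin n))) with hw
  have h0 : w a0 = 0 := by simp [hw, partnerWeight, hp, coverPartner]
  have h1 (i) : w (a i) + w (a' i) + 2 * (if i ∈ U then 1 else 0) = 4 := by
    by_cases h : i ∈ U <;> simp [hw, partnerWeight, hp, coverPartner, weight_mk, h, n1, n2,
      Heavy.a_b, Heavy.a'_b']
  have h2 (e) : w (s e) + w (s' e) + w (s'' e) = 5 := by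
    by_cases h : e.1.inf ∈ U <;> simp [hw, partnerWeight, hp, coverPartner, weight_mk, h, n3, n4,
      Heavy.s_t', Heavy.s_t'', Heavy.s'_t, Heavy.s''_t]
  have h4 := Finset.sum_congr rfl fun i (_ : i ∈ Finset.univ) => h1 i
  rw [Finset.sum_add_distrib, ← Finset.mul_sum, ← Finset.card_filter] at h4
  rw [matchingWeight_eq_sum (coverMatching_isMatching H U), sum_aVert, ← hw, h0,
    Finset.sum_congr rfl fun e _ => h2 e]
  simp [h3] at h4 ⊢
  zify at h4
  linarith

end Cover

end Gadget

theorem mainTheorem6 (n : ℕ) (H : SimpleGraph (Fin n)) (c : Gadget.Choices H)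
    (k : ℕ) (hk1 : 1 ≤ k) (hkn : k ≤ n) :
    (∃ U : Finset (Fin n), H.IsVertexCover (U : Set (Fin n)) ∧ U.card = k) ↔
      ∃ M : (Gadget.graph H).Subgraph, (Gadget.prefs c).IsPopular M ∧
        5 * (H.edgeSet.ncard : ℤ) + 4 * (n : ℤ) - 2 * (k : ℤ) ≤
          (matchingWeight (Gadget.weight H) M : ℤ) := by
  constructor
  · rintro ⟨U, hU, rfl⟩
    exact ⟨Gadget.coverMatching H U, Gadget.coverMatching_isPopular c hU,
      (Gadget.matchingWeight_coverMatching U).ge⟩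
  · rintro ⟨M, hM, hk⟩
    obtain ⟨U, hU, hUk⟩ := Gadget.exists_vertexCover_of_isPopular hM k hk
    -- Supersets of covers are covers, so `k ≤ n` allows padding to size exactly `k`.
    obtain ⟨W, hUW, hW⟩ := Finset.exists_superset_card_eq hUk (by simpa using hkn)
    exact ⟨W, SimpleGraph.IsVertexCover.subset (by exact_mod_cast hUW) hU, hW⟩
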